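/- Let $D\subseteq R\subseteq B$ be integral domains such that $D$ and $R$ share a nonzero ideal $I$ (a nonzero subset $I\subseteq D$ that is an ideal of both $D$ and $R$), with $D/I$ finite, and let $E$ be a nonempty subset of the quotient field $K$ of $D$. For a subring $A$ of $B$ put $\mathrm{Int}_B(E,A)=\{f\in B[X] : f(E)\subseteq A\}$, where polynomials are evaluated in the quotient field of $B$. Let $\dim$ denote Krull dimension, and let $\dim_v(R)$ denote the valuative dimension of $R$, that is, the supremum of $\dim(V)$ over all valuation rings $V$ with $R\subseteq V$ contained in, and having as quotient field, the quotient field of $R$. Then $$\dim(\mathrm{Int}_B(E,D))\le \dim(\mathrm{Int}_B(E,R)).$$ Suppose in addition that $E$ is a fractional subset of $D$ (there is a nonzero $d\in D$ with $dE\subseteq D$) and that $E\subseteq R$. Then $$1+\dim(D)\le \dim(\mathrm{Int}_B(E,D)),$$ and, provided that $E$ is infinite or that $B$ is algebraic over $D$ (for example $B\subseteq K$, i.e. $B$ is an overring of $D$), $$\dim(\mathrm{Int}_B(E,D))\le 1+\dim_v(R).$$ -/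

import Mathlib

/-- The valuative dimension of an integral domain `R`: the supremum of the Krull dimensions of
the valuation overrings of `R`, i.e. of the valuation rings `V` of the quotient field of `R` that
contain `R`. -/
noncomputable def valuativeDim (R : Type*) [CommRing R] [IsDomain R] : WithBot ℕ∞ :=
  ⨆ V : {V : ValuationSubring (FractionRing R) //
      ∀ r : R, algebraMap R (FractionRing R) r ∈ V}, ringKrullDim V.1

/-- `intPoly B E D` is the ring `Int_B(E, D) = {f ∈ B[X] : f(E) ⊆ D}`, where `B` and `D` are
subrings of a field `L`, `E` is a subset of `L`, and polynomials are evaluated in `L`. -/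
def intPoly {L : Type*} [Field L] (B : Subring L) (E : Set L) (D : Subring L) :
    Subring (Polynomial B) where
  carrier := {f | ∀ e ∈ E, f.eval₂ B.subtype e ∈ D}
  zero_mem' e _ := by simp
  one_mem' e _ := by simp
  add_mem' hf hg e he := by
    rw [Polynomial.eval₂_add]
    exact D.add_mem (hf e he) (hg e he)
  mul_mem' hf hg e he := by
    rw [Polynomial.eval₂_mul]
    exact D.mul_mem (hf e he) (hg e he)
  neg_mem' hf e he := by
    rw [Polynomial.eval₂_neg]
    exact D.neg_mem (hf e he)

/-- `E` is a fractional subset of `D`: there is a nonzero `d ∈ D` with `d E ⊆ D`. -/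
def IsFractionalSubset {L : Type*} [Field L] (D : Subring L) (E : Set L) : Prop :=
  ∃ d ∈ D, d ≠ 0 ∧ ∀ e ∈ E, d * e ∈ D

/-! For the first inequality, the polynomials with values in the common ideal form an ideal shared
by `Int(E, D)` and `Int(E, R)`. Primes of `Int(E, D)` not containing it lift to `Int(E, R)` with
order preserved, by `P ↦ {x | x J ⊆ P}`. Since `D/I` is finite, some `f ^ n - f ^ m` with `m < n`
takes values in `I` for every `f`, so a prime containing the shared ideal is maximal. It can only
end a chain, where a prime above the previous lift replaces it (`ringKrullDim_le_of_common_ideal`).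

The lower bound holds because evaluation at a point of `E` maps `Int(E, D)` onto `D` with nonzero
kernel.

For the upper bound it suffices to treat `A = Int(E, R)`, which has transcendence degree at most one
over `R`. A chain of primes of `A` is realised as centers of decreasing valuation rings of `Frac A`.
Their traces on `Frac R` coincide at most once in succession: two coincidences would give two
algebraically independent elements (`algebraicIndependent_of_comap_eq`). So only one step of the
chain is lost. -/

/-! ### Lifting primes across a common ideal. -/

theorem Ideal.exists_map_eq_mul_of_image_eq {R S : Type*} [CommRing R] [CommRing S] {f : R →+* S}
    {J : Ideal R} {J' : Ideal S} (hJ : f '' (J : Set R) = J') (x : S) {a : R} (ha : a ∈ J) :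
    ∃ b ∈ J, f b = x * f a := by
  have : x * f a ∈ (J' : Set S) :=
    J'.mul_mem_left x (hJ.subset (Set.mem_image_of_mem f ha))
  rwa [← hJ] at this

/-- The ideal `{x | x J ⊆ P}` of `S`, where the ideal `J` of `R` maps onto an ideal of `S`. -/
def Ideal.conductorLift {R S : Type*} [CommRing R] [CommRing S] (f : R →+* S)
    (hf : Function.Injective f) {J : Ideal R} {J' : Ideal S} (hJ : f '' (J : Set R) = J')
    (P : Ideal R) : Ideal S where
  carrier := {x | ∀ a ∈ J, ∀ b, f b = x * f a → b ∈ P}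
  zero_mem' a _ b hb := by
    rw [zero_mul, map_eq_zero_iff f hf] at hb
    exact hb ▸ P.zero_mem
  add_mem' {x y} hx hy a ha b hb := by
    obtain ⟨c, -, hc⟩ := exists_map_eq_mul_of_image_eq hJ x ha
    obtain ⟨d, -, hd⟩ := exists_map_eq_mul_of_image_eq hJ y ha
    have : b = c + d := hf (by rw [hb, map_add, hc, hd, add_mul])
    exact this ▸ P.add_mem (hx a ha c hc) (hy a ha d hd)
  smul_mem' z x hx a ha b hb := by
    obtain ⟨c, hc, hc'⟩ := exists_map_eq_mul_of_image_eq hJ z ha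
    exact hx c hc b (by rw [hb, hc', smul_eq_mul]; ring)

section CommonIdeal

variable {R S : Type*} [CommRing R] [CommRing S] {f : R →+* S} (hf : Function.Injective f)
  {J : Ideal R} {J' : Ideal S} (hJ : f '' (J : Set R) = J')

/-- An element `a ∈ J` outside `P` can be cancelled from `x * a ∈ P`. So the lift contracts back to
`P`, which makes lifting injective. -/
theorem Ideal.map_mem_conductorLift_iff {P : Ideal R} (hP : P.IsPrime) (hJP : ¬ J ≤ P) (x : R) :
    f x ∈ conductorLift f hf hJ P ↔ x ∈ P := by
  constructor
  · intro hx
    obtain ⟨a, ha, haP⟩ := SetLike.not_le_iff_exists.mp hJP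
    exact (hP.mem_or_mem (hx a ha (x * a) (map_mul f x a))).resolve_right haP
  · intro hx a _ b hb
    rw [← map_mul] at hb
    exact hf hb ▸ P.mul_mem_right a hx

theorem Ideal.conductorLift_isPrime {P : Ideal R} (hP : P.IsPrime) (hJP : ¬ J ≤ P) :
    (conductorLift f hf hJ P).IsPrime := by
  refine ⟨fun h ↦ ?_, fun {x y} hxy ↦ ?_⟩
  · have h1 := (map_mem_conductorLift_iff hf hJ hP hJP 1).mp (h ▸ Submodule.mem_top)
    exact hP.ne_top ((Ideal.eq_top_iff_one P).mpr h1)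
  · by_contra! h
    obtain ⟨hx, hy⟩ := h
    have hx' : ∃ a ∈ J, ∃ b, f b = x * f a ∧ b ∉ P := by
      by_contra! h; exact hx h
    have hy' : ∃ a ∈ J, ∃ b, f b = y * f a ∧ b ∉ P := by
      by_contra! h; exact hy h
    obtain ⟨a, ha, b, hb, hbP⟩ := hx'
    obtain ⟨a', ha', b', hb', hbP'⟩ := hy'
    have := hxy (a * a') (J.mul_mem_right a' ha) (b * b') (by
      rw [map_mul, map_mul, hb, hb']; ring)
    exact (hP.mem_or_mem this).elim hbP hbP'

theorem Ideal.conductorLift_mono {P Q : Ideal R} (h : P ≤ Q) :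
    conductorLift f hf hJ P ≤ conductorLift f hf hJ Q :=
  fun _ hx a ha b hb ↦ h (hx a ha b hb)

theorem Ideal.conductorLift_lt {P Q : Ideal R} (hP : P.IsPrime) (hQ : Q.IsPrime) (hJP : ¬ J ≤ P)
    (hJQ : ¬ J ≤ Q) (h : P < Q) : conductorLift f hf hJ P < conductorLift f hf hJ Q := by
  refine lt_of_le_not_ge (conductorLift_mono hf hJ h.le) fun h' ↦ h.not_ge fun x hx ↦ ?_
  exact (map_mem_conductorLift_iff hf hJ hP hJP x).mp
    (h' ((map_mem_conductorLift_iff hf hJ hQ hJQ x).mpr hx))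

/-- A prime `P` of `R` not containing `J`, but lying below a prime that does, lifts to a prime
of `S` that is properly contained in a prime containing `J'`. -/
theorem Ideal.exists_isPrime_conductorLift_le {P Q : Ideal R} (hP : P.IsPrime) (hQ : Q.IsPrime)
    (hJP : ¬ J ≤ P) (hJQ : J ≤ Q) (h : P ≤ Q) :
    ∃ M : Ideal S, M.IsPrime ∧ conductorLift f hf hJ P ≤ M ∧ J' ≤ M := by
  -- If `1 = q + f i` with `i ∈ J`, then `1 - i` lies in `P ≤ Q` and `i` in `J ≤ Q`, which is
  -- absurd.
  have hne : conductorLift f hf hJ P ⊔ J' ≠ ⊤ := by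
    intro htop
    obtain ⟨q, hq, j, hj, hqj⟩ := Submodule.mem_sup.mp ((Ideal.eq_top_iff_one _).mp htop)
    have hj' : j ∈ (J' : Set S) := hj
    rw [← hJ] at hj'
    obtain ⟨i, hi, rfl⟩ := hj'
    have hq' : q = f (1 - i) := by rw [map_sub, map_one, ← hqj]; ring
    rw [hq', map_mem_conductorLift_iff hf hJ hP hJP] at hq
    apply hQ.ne_top
    rw [Ideal.eq_top_iff_one, ← sub_add_cancel 1 i]
    exact Q.add_mem (h hq) (hJQ hi)
  obtain ⟨M, hM, hle⟩ := Ideal.exists_le_maximal _ hne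
  exact ⟨M, hM.isPrime, le_sup_left.trans hle, le_sup_right.trans hle⟩

include hf hJ in
/-- If `R ⊆ S` share an ideal `J` such that every prime of `R` containing `J` is maximal, then
`dim R ≤ dim S`. -/
theorem ringKrullDim_le_of_common_ideal
    (hmax : ∀ P : Ideal R, P.IsPrime → J ≤ P → P.IsMaximal) :
    ringKrullDim R ≤ ringKrullDim S := by
  refine iSup_le fun p ↦ ?_
  have : Nontrivial R := p.head.nontrivial
  have : Nontrivial S := hf.nontrivial
  let Q : ∀ P : PrimeSpectrum R, ¬ J ≤ P.asIdeal → PrimeSpectrum S := fun P h ↦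
    ⟨Ideal.conductorLift f hf hJ P.asIdeal, Ideal.conductorLift_isPrime hf hJ P.isPrime h⟩
  -- A single `M` suffices: choose it above the lift of the largest chain member not containing `J`.
  have key : ∃ M : PrimeSpectrum S, ∀ i j, i < j → J ≤ (p j).asIdeal →
      ∀ h : ¬ J ≤ (p i).asIdeal, Q (p i) h < M := by
    by_cases hlast : ∃ i, ¬ J ≤ (p i).asIdeal ∧ ∃ j, i < j ∧ J ≤ (p j).asIdeal
    · classical
      let s : Finset (Fin (p.length + 1)) := Finset.univ.filter fun i ↦ ¬ J ≤ (p i).asIdeal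
      have hs : s.Nonempty := by
        obtain ⟨i, hi, -⟩ := hlast
        exact ⟨i, by simpa [s] using hi⟩
      have hms : ¬ J ≤ (p (s.max' hs)).asIdeal := by simpa [s] using s.max'_mem hs
      obtain ⟨i, hi, j, hij, hj⟩ := hlast
      have hmj : s.max' hs < j := by
        by_contra! h
        exact hms (hj.trans (p.monotone h))
      obtain ⟨M, hM, hle, hJM⟩ := Ideal.exists_isPrime_conductorLift_le hf hJ
        (p (s.max' hs)).isPrime (p j).isPrime hms hj (p.monotone hmj.le)
      refine ⟨⟨M, hM⟩, fun i' j' _ _ h ↦ ?_⟩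
      have hi' : i' ≤ s.max' hs := s.le_max' _ (by simpa [s] using h)
      have hle' : (Q (p i') h).asIdeal ≤ M :=
        (Ideal.conductorLift_mono hf hJ (p.monotone hi')).trans hle
      refine lt_of_le_not_ge hle' fun hge ↦ h fun a ha ↦ ?_
      exact (Ideal.map_mem_conductorLift_iff hf hJ (p i').isPrime h a).mp
        (hge (hJM (show f a ∈ (J' : Set S) from hJ.subset <| Set.mem_image_of_mem f ha)))
    · push Not at hlast
      exact ⟨Classical.arbitrary _, fun i j hij hj h ↦ absurd hj (hlast i h j hij)⟩
  obtain ⟨M, hM⟩ := key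
  classical
  -- By maximality only the last member of the chain can contain `J`; there `M` stands in for the
  -- missing lift.
  have hmono : StrictMono fun i ↦ if h : ¬ J ≤ (p i).asIdeal then Q (p i) h else M := by
    intro i j hij
    have hi : ¬ J ≤ (p i).asIdeal := fun h ↦
      (p.strictMono hij).not_ge (((hmax _ (p i).isPrime h).eq_of_le
        (p j).isPrime.ne_top (p.monotone hij.le)).ge)
    by_cases hj : J ≤ (p j).asIdeal
    · simpa [hi, hj] using hM i j hij hj hi
    · simp only [hi, hj, not_false_eq_true, dif_pos]
      exact Ideal.conductorLift_lt hf hJ (p i).isPrime (p j).isPrime hi hj (p.strictMono hij)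
  exact Order.LTSeries.length_le_krullDim (LTSeries.mk p.length _ hmono)

end CommonIdeal

/-! ### Maximality from a uniform power identity. -/

theorem Ideal.IsPrime.isMaximal_of_pow_sub_pow_mem {R : Type*} [CommRing R] {P : Ideal R}
    (hP : P.IsPrime) {m n : ℕ} (hmn : m < n) (h : ∀ a, a ^ n - a ^ m ∈ P) : P.IsMaximal := by
  apply Ideal.Quotient.maximal_of_isField
  refine ⟨⟨0, 1, zero_ne_one⟩, mul_comm, fun {x} hx ↦ ?_⟩
  obtain ⟨a, rfl⟩ := Ideal.Quotient.mk_surjective x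
  have h1 : Ideal.Quotient.mk P a ^ n = Ideal.Quotient.mk P a ^ m := by
    rw [← sub_eq_zero, ← map_pow, ← map_pow, ← map_sub, Ideal.Quotient.eq_zero_iff_mem]
    exact h a
  obtain ⟨k, rfl⟩ := Nat.exists_eq_add_of_lt hmn
  refine ⟨Ideal.Quotient.mk P a ^ k, mul_left_cancel₀ (pow_ne_zero m hx) ?_⟩
  rw [mul_one]
  refine Eq.trans ?_ h1
  ring

/-- Pigeonhole on the power maps `M → M`, of which only finitely many are distinct; hence exponents
independent of `x`. -/
theorem exists_pow_eq_pow_of_finite (M : Type*) [Monoid M] [Finite M] :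
    ∃ m n : ℕ, m < n ∧ ∀ x : M, x ^ n = x ^ m := by
  obtain ⟨m, n, hne, h⟩ := Finite.exists_ne_map_eq_of_infinite fun (k : ℕ) (x : M) ↦ x ^ k
  rcases hne.lt_or_gt with hlt | hlt
  · exact ⟨m, n, hlt, fun x ↦ (congrFun h x).symm⟩
  · exact ⟨n, m, hlt, fun x ↦ congrFun h x⟩

/-! ### Valuation rings with prescribed centers. -/

namespace ValuationSubring

variable {F : Type*} [Field F]

theorem valuation_eq_one_iff_mem {W : ValuationSubring F} {x : F} (hx : x ≠ 0) :
    W.valuation x = 1 ↔ x ∈ W ∧ x⁻¹ ∈ W := by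
  rw [← W.valuation_le_one_iff, ← W.valuation_le_one_iff, ← W.valuation.one_le_val_iff hx]
  exact le_antisymm_iff

theorem valuation_eq_one_of_le {W W' : ValuationSubring F} (h : W ≤ W') {x : F}
    (hx : W.valuation x = 1) : W'.valuation x = 1 := by
  have hx0 : x ≠ 0 := by rintro rfl; simp at hx
  rw [valuation_eq_one_iff_mem hx0] at hx ⊢
  exact ⟨h hx.1, h hx.2⟩

theorem valuation_map_eq_one_iff_comap {K : Type*} [Field K] (φ : K →+* F)
    (W : ValuationSubring F) (c : K) :
    W.valuation (φ c) = 1 ↔ (W.comap φ).valuation c = 1 := by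
  rcases eq_or_ne c 0 with rfl | hc
  · simp
  · rw [valuation_eq_one_iff_mem hc, valuation_eq_one_iff_mem ((map_ne_zero φ).mpr hc), mem_comap,
      mem_comap, map_inv₀]

theorem eq_zero_of_valuation_zpow_eq_one {W : ValuationSubring F} {t : F} (ht : W.valuation t < 1)
    {k : ℤ} (h : W.valuation (t ^ k) = 1) : k = 0 := by
  rwa [map_zpow₀, zpow_eq_one_iff_right₀ zero_le ht.ne] at h

theorem valuation_mul_lt_one (W : ValuationSubring F) {x y : F} (hx : W.valuation x < 1)
    (hy : W.valuation y ≤ 1) : W.valuation (x * y) < 1 := by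
  rw [map_mul]
  exact (mul_le_of_le_one_right zero_le hy).trans_lt hx

/-- Every prime ideal of a subring of a field is the center of a valuation ring. -/
theorem exists_center_eq (S : Subring F) (P : Ideal S) [P.IsPrime] :
    ∃ V : ValuationSubring F, S ≤ V.toSubring ∧ ∀ x : S, V.valuation x < 1 ↔ x ∈ P := by
  obtain ⟨V, hle, hloc⟩ := (LocalSubring.ofPrime S P).exists_le_valuationSubring
  have hS := (LocalSubring.le_ofPrime S P).trans hle
  refine ⟨V, hS, fun x ↦ ?_⟩
  have hu : IsUnit (Subring.inclusion hle (algebraMap S _ x)) ↔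
      IsUnit (algebraMap S (LocalSubring.ofPrime S P).toSubring x) := isUnit_map_iff _ _
  rw [← IsLocalization.AtPrime.to_map_mem_maximal_iff (LocalSubring.ofPrime S P).toSubring P x,
    IsLocalRing.mem_maximalIdeal, _root_.mem_nonunits_iff, ← hu]
  exact (V.valuation_lt_one_iff (Subring.inclusion hle (algebraMap S _ x))).symm.trans
    (IsLocalRing.mem_maximalIdeal _)

section Center

variable {A : Type*} [CommRing A] (φ : A →+* F)

/-- `P` is the center of `W` on `A`. -/
structure HasCenter (W : ValuationSubring F) (P : Ideal A) : Prop where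
  valuation_le_one : ∀ a, W.valuation (φ a) ≤ 1
  valuation_lt_one_iff : ∀ a, W.valuation (φ a) < 1 ↔ a ∈ P

variable {φ}

theorem HasCenter.valuation_eq_one {W : ValuationSubring F} {P : Ideal A} (h : W.HasCenter φ P)
    {a : A} (ha : a ∉ P) : W.valuation (φ a) = 1 :=
  (h.valuation_le_one a).antisymm (not_lt.mp ((h.valuation_lt_one_iff a).not.mpr ha))

variable (φ) in
/-- Elements of `F` that are congruent to an element of the image of `A` modulo the maximal ideal
of `W`. -/
def addMaximalIdeal (W : ValuationSubring F) (hA : ∀ a, W.valuation (φ a) ≤ 1) : Subring F where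
  carrier := {x | ∃ a, W.valuation (x - φ a) < 1}
  zero_mem' := ⟨0, by simp⟩
  one_mem' := ⟨1, by simp⟩
  add_mem' := by
    rintro x y ⟨a, ha⟩ ⟨b, hb⟩
    refine ⟨a + b, ?_⟩
    rw [map_add, add_sub_add_comm]
    exact W.valuation.map_add_lt ha hb
  neg_mem' := by
    rintro x ⟨a, ha⟩
    refine ⟨-a, ?_⟩
    rwa [map_neg, neg_sub_neg, W.valuation.map_sub_swap]
  mul_mem' := by
    rintro x y ⟨a, ha⟩ ⟨b, hb⟩
    refine ⟨a * b, ?_⟩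
    have hy : W.valuation y ≤ 1 := by
      rw [← sub_add_cancel y (φ b)]
      exact W.valuation.map_add_le hb.le (hA b)
    rw [map_mul, show x * y - φ a * φ b = (x - φ a) * y + φ a * (y - φ b) by ring]
    refine W.valuation.map_add_lt ?_ ?_
    · exact W.valuation_mul_lt_one ha hy
    · rw [mul_comm]
      exact W.valuation_mul_lt_one hb (hA a)

/-- The ideal of `W.addMaximalIdeal φ hA` of elements congruent to an element of the image of the
ideal `Q` of `A`. -/
def idealAddMaximalIdeal (W : ValuationSubring F) (hA : ∀ a, W.valuation (φ a) ≤ 1)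
    (Q : Ideal A) : Ideal (W.addMaximalIdeal φ hA) where
  carrier := {x | ∃ a ∈ Q, W.valuation (x - φ a) < 1}
  zero_mem' := ⟨0, Q.zero_mem, by simp⟩
  add_mem' := by
    rintro x y ⟨a, haQ, ha⟩ ⟨b, hbQ, hb⟩
    refine ⟨a + b, Q.add_mem haQ hbQ, ?_⟩
    rw [map_add, Subring.coe_add, add_sub_add_comm]
    exact W.valuation.map_add_lt ha hb
  smul_mem' := by
    rintro ⟨x, b, hb⟩ y ⟨a, haQ, ha⟩
    refine ⟨b * a, Q.mul_mem_left b haQ, ?_⟩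
    have hx : W.valuation x ≤ 1 := by
      rw [← sub_add_cancel x (φ b)]
      exact W.valuation.map_add_le hb.le (hA b)
    rw [map_mul, smul_eq_mul, Subring.coe_mul,
      show x * (y : F) - φ b * φ a = x * (y - φ a) + (x - φ b) * φ a by ring]
    refine W.valuation.map_add_lt ?_ ?_
    · rw [mul_comm]
      exact W.valuation_mul_lt_one ha hx
    · exact W.valuation_mul_lt_one hb (hA a)

/-- Two representatives of `x` in `A` differ by an element of `P ≤ Q`, so membership in `Q` does not
depend on the choice. -/
theorem HasCenter.mem_of_mem_idealAddMaximalIdeal {W : ValuationSubring F} {P Q : Ideal A}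
    (h : W.HasCenter φ P) (hPQ : P ≤ Q) {x : W.addMaximalIdeal φ h.valuation_le_one}
    (hx : x ∈ W.idealAddMaximalIdeal h.valuation_le_one Q) {a : A}
    (ha : W.valuation (x - φ a) < 1) : a ∈ Q := by
  obtain ⟨b, hbQ, hb⟩ := hx
  rw [← sub_add_cancel a b]
  refine Q.add_mem (hPQ ((h.valuation_lt_one_iff _).mp ?_)) hbQ
  rw [map_sub, ← sub_sub_sub_cancel_left (φ b) (φ a) (x : F)]
  exact W.valuation.map_sub_lt hb ha

theorem HasCenter.idealAddMaximalIdeal_isPrime {W : ValuationSubring F} {P Q : Ideal A}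
    (h : W.HasCenter φ P) (hPQ : P ≤ Q) (hQ : Q.IsPrime) :
    (W.idealAddMaximalIdeal h.valuation_le_one Q).IsPrime := by
  refine ⟨fun htop ↦ hQ.ne_top ?_, ?_⟩
  · rw [Ideal.eq_top_iff_one]
    exact h.mem_of_mem_idealAddMaximalIdeal hPQ (x := 1) (htop ▸ Submodule.mem_top) (by simp)
  · rintro ⟨x, a, ha⟩ ⟨y, b, hb⟩ hxy
    have hy : W.valuation y ≤ 1 := by
      rw [← sub_add_cancel y (φ b)]
      exact W.valuation.map_add_le hb.le (h.valuation_le_one b)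
    have hab : a * b ∈ Q := h.mem_of_mem_idealAddMaximalIdeal hPQ hxy (by
      change W.valuation (x * y - _) < 1
      rw [map_mul, show x * y - φ a * φ b = (x - φ a) * y + φ a * (y - φ b) by ring]
      refine W.valuation.map_add_lt ?_ ?_
      · exact W.valuation_mul_lt_one ha hy
      · rw [mul_comm]
        exact W.valuation_mul_lt_one hb (h.valuation_le_one a))
    exact (hQ.mem_or_mem hab).imp (⟨a, ·, ha⟩) (⟨b, ·, hb⟩)

/-- If `W` has center `P` on `A` and `Q` is a prime of `A` containing `P`, then some valuation ring
contained in `W` has center `Q`. -/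
theorem HasCenter.exists_le_hasCenter {W : ValuationSubring F} {P Q : Ideal A}
    (h : W.HasCenter φ P) (hPQ : P ≤ Q) (hQ : Q.IsPrime) :
    ∃ W' ≤ W, W'.HasCenter φ Q := by
  have := h.idealAddMaximalIdeal_isPrime hPQ hQ
  obtain ⟨V, hV, hc⟩ := exists_center_eq _ (W.idealAddMaximalIdeal h.valuation_le_one Q)
  refine ⟨V, ?_, fun a ↦ ?_, fun a ↦ ?_⟩
  -- Containment of valuation rings reverses on maximal ideals, and that of `W` lies in the chosen
  -- ideal, being congruent to `0`.
  · rw [← nonunits_le_nonunits]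
    intro x hx
    have hx' : W.valuation (x - φ 0) < 1 := by simpa using W.mem_nonunits_iff.mp hx
    exact (hc ⟨x, 0, hx'⟩).mpr ⟨0, Q.zero_mem, hx'⟩
  · exact (V.valuation_le_one_iff _).mpr (hV ⟨a, by simp⟩)
  · refine (hc ⟨φ a, a, by simp⟩).trans ⟨fun ha ↦ ?_, fun ha ↦ ⟨a, ha, by simp⟩⟩
    exact h.mem_of_mem_idealAddMaximalIdeal hPQ ha (by simp)

theorem hasCenter_top_bot (hφ : Function.Injective φ) :
    (⊤ : ValuationSubring F).HasCenter φ ⊥ := by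
  refine ⟨fun a ↦ (valuation_le_one_iff _ _).mpr (mem_top _), fun a ↦ ?_⟩
  rw [← mem_nonunits_iff, mem_nonunits_iff_or, Ideal.mem_bot, map_eq_zero_iff φ hφ]
  simp [mem_top]

/-- An increasing sequence of primes of `A` is the sequence of centers of a decreasing sequence of
valuation rings. -/
theorem exists_antitone_hasCenter (hφ : Function.Injective φ) {P : ℕ → Ideal A}
    (hP : ∀ k, (P k).IsPrime) (hmono : Monotone P) :
    ∃ W : ℕ → ValuationSubring F, Antitone W ∧ ∀ k, (W k).HasCenter φ (P k) := by
  obtain ⟨W₀, -, h₀⟩ := (hasCenter_top_bot hφ).exists_le_hasCenter bot_le (hP 0)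
  choose next hle hnext using fun (k : ℕ) (W : {W : ValuationSubring F // W.HasCenter φ (P k)}) ↦
    W.2.exists_le_hasCenter (hmono k.le_succ) (hP (k + 1))
  let W : ∀ k, {W : ValuationSubring F // W.HasCenter φ (P k)} := fun k ↦
    Nat.rec ⟨W₀, h₀⟩ (fun k W ↦ ⟨next k W, hnext k W⟩) k
  exact ⟨fun k ↦ (W k).1, antitone_nat_of_succ_le fun k ↦ hle k (W k), fun k ↦ (W k).2⟩

end Center

/-! ### Algebraic independence from equal traces. -/

section AlgebraicIndependent

variable {R : Type*} [CommRing R] [Algebra R F] [FaithfulSMul R F]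

/-- A nontrivial algebraic relation between nonzero elements `t` and `s` has two different
monomials of the same value. -/
theorem exists_valuation_zpow_eq_one_of_not_algebraicIndependent (W : ValuationSubring F) {t s : F}
    (ht : t ≠ 0) (hs : s ≠ 0) (h : ¬ AlgebraicIndependent R ![t, s]) :
    ∃ a b : R, ∃ k l : ℤ, (k ≠ 0 ∨ l ≠ 0) ∧
      W.valuation (algebraMap R F a / algebraMap R F b * t ^ k * s ^ l) = 1 := by
  classical
  rw [algebraicIndependent_iff] at h
  push Not at h
  obtain ⟨p, hp, hp0⟩ := h
  rw [MvPolynomial.aeval_def, MvPolynomial.eval₂_eq'] at hp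
  simp only [Fin.prod_univ_two, Matrix.cons_val_zero, Matrix.cons_val_one] at hp
  set g : (Fin 2 →₀ ℕ) → F := fun d ↦ algebraMap R F (p.coeff d) * (t ^ d 0 * s ^ d 1) with hg
  have hg0 : ∀ d ∈ p.support, g d ≠ 0 := fun d hd ↦ by
    have := (map_ne_zero_iff _ (FaithfulSMul.algebraMap_injective R F)).mpr
      (MvPolynomial.mem_support_iff.mp hd)
    exact mul_ne_zero this (mul_ne_zero (pow_ne_zero _ ht) (pow_ne_zero _ hs))
  obtain ⟨d, hd, hmax⟩ := p.support.exists_max_image (fun d ↦ W.valuation (g d))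
    (MvPolynomial.support_nonempty.mpr hp0)
  have : ∃ d' ∈ p.support, d' ≠ d ∧ W.valuation (g d') = W.valuation (g d) := by
    by_contra! hne
    -- A unique term of maximal value would determine the value of the sum, which is zero.
    have hsum := W.valuation.map_sum_eq_of_lt (f := g) hd fun i hi ↦ by
      rw [Finset.mem_sdiff, Finset.mem_singleton] at hi
      exact (hmax i hi.1).lt_of_ne (hne i hi.1 hi.2)
    rw [hp, map_zero] at hsum
    exact hg0 d hd ((map_eq_zero _).mp hsum.symm)
  obtain ⟨d', hd', hne, hval⟩ := this
  refine ⟨p.coeff d', p.coeff d, d' 0 - d 0, d' 1 - d 1, ?_, ?_⟩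
  · by_contra! h
    apply hne
    ext i
    fin_cases i
    · exact_mod_cast sub_eq_zero.mp h.1
    · exact_mod_cast sub_eq_zero.mp h.2
  · have hquot : algebraMap R F (p.coeff d') / algebraMap R F (p.coeff d) *
        t ^ ((d' 0 : ℤ) - d 0) * s ^ ((d' 1 : ℤ) - d 1) = g d' / g d := by
      rw [zpow_sub₀ ht, zpow_sub₀ hs, hg]
      simp only [zpow_natCast]
      rw [mul_div_mul_comm, mul_div_mul_comm, mul_assoc]
    rw [hquot, map_div₀, hval, div_self ((map_ne_zero _).mpr (hg0 d hd))]

variable {K : Type*} [Field K] [Algebra R K] {ψ : K →+* F}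

/-- Let `W₄ ≤ W₃ ≤ W₂ ≤ W₁` be valuation rings of `F` such that the traces of `W₁` and `W₂` on the
subfield `K` agree, and likewise those of `W₃` and `W₄`. Elements witnessing `W₂ < W₁` and
`W₄ < W₃` are algebraically independent. -/
theorem algebraicIndependent_of_comap_eq (hψ : ψ.comp (algebraMap R K) = algebraMap R F)
    {W₁ W₂ W₃ W₄ : ValuationSubring F} (h₂₁ : W₂ ≤ W₁) (h₃₂ : W₃ ≤ W₂) (h₄₃ : W₄ ≤ W₃)
    (e₁₂ : W₁.comap ψ = W₂.comap ψ) (e₃₄ : W₃.comap ψ = W₄.comap ψ) {t s : F}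
    (ht₁ : W₁.valuation t = 1) (ht₂ : W₂.valuation t < 1)
    (hs₃ : W₃.valuation s = 1) (hs₄ : W₄.valuation s < 1) :
    AlgebraicIndependent R ![t, s] := by
  by_contra h
  obtain ⟨a, b, k, l, hkl, hval⟩ :=
    exists_valuation_zpow_eq_one_of_not_algebraicIndependent W₄
      (by rintro rfl; simp at ht₁) (by rintro rfl; simp at hs₃) h
  have hc : algebraMap R F a / algebraMap R F b = ψ (algebraMap R K a / algebraMap R K b) := by
    rw [map_div₀, ← hψ]; rfl
  rw [hc] at hval
  generalize algebraMap R K a / algebraMap R K b = c at hval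
  have trace {W W' : ValuationSubring F} (e : W.comap ψ = W'.comap ψ)
      (h : W.valuation (ψ c) = 1) : W'.valuation (ψ c) = 1 := by
    rwa [valuation_map_eq_one_iff_comap, ← e, ← valuation_map_eq_one_iff_comap]
  have hs₂ := valuation_eq_one_of_le h₃₂ hs₃
  -- Coarsening to `W₂` removes `s`, and then to `W₁` removes `t`. Equality of traces returns `ψ c`
  -- to a unit of `W₂`, forcing `k = 0`; the pair `W₃`, `W₄` then forces `l = 0`.
  have h₂ : W₂.valuation (ψ c * t ^ k) = 1 := by
    have := valuation_eq_one_of_le (h₄₃.trans h₃₂) hval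
    rwa [map_mul, map_zpow₀, hs₂, one_zpow, mul_one] at this
  have hc₁ : W₁.valuation (ψ c) = 1 := by
    have := valuation_eq_one_of_le h₂₁ h₂
    rwa [map_mul, map_zpow₀, ht₁, one_zpow, mul_one] at this
  rw [map_mul, trace e₁₂ hc₁, one_mul] at h₂
  obtain rfl := eq_zero_of_valuation_zpow_eq_one ht₂ h₂
  rw [zpow_zero, mul_one] at hval
  have hc₃ : W₃.valuation (ψ c) = 1 := by
    have := valuation_eq_one_of_le h₄₃ hval
    rwa [map_mul, map_zpow₀, hs₃, one_zpow, mul_one] at this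
  rw [map_mul, trace e₃₄ hc₃, one_mul] at hval
  obtain rfl := eq_zero_of_valuation_zpow_eq_one hs₄ hval
  simp at hkl

end AlgebraicIndependent

/-- A chain of `n + 1` valuation rings of `K` containing `V` bounds the dimension of `V` below. -/
theorem le_ringKrullDim_of_strictAnti {K : Type*} [Field K] {V : ValuationSubring K} {n : ℕ}
    {U : Fin (n + 1) → ValuationSubring K} (hU : StrictAnti U) (hV : ∀ i, V ≤ U i) :
    n ≤ ringKrullDim V := by
  -- Primes of `V` correspond, in reverse order, to valuation rings containing `V`.
  rw [ringKrullDim, ← Order.krullDim_orderDual, Order.krullDim_eq_of_orderIso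
    V.primeSpectrumOrderEquiv, ← Order.krullDim_orderDual]
  exact Order.LTSeries.length_le_krullDim
    (LTSeries.mk n (fun i ↦ OrderDual.toDual (⟨U i, hV i⟩ : {S // V ≤ S})) fun i j hij ↦ hU hij)

end ValuationSubring

/-! ### Dimension in transcendence degree at most one. -/

theorem ringKrullDim_le_valuativeDim (R : Type*) [CommRing R] [IsDomain R]
    (V : ValuationSubring (FractionRing R)) (hV : ∀ r : R, algebraMap R (FractionRing R) r ∈ V) :
    ringKrullDim V ≤ valuativeDim R :=
  le_iSup (fun V : {V : ValuationSubring (FractionRing R) //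
    ∀ r : R, algebraMap R (FractionRing R) r ∈ V} ↦ ringKrullDim V.1) ⟨V, hV⟩

theorem zero_le_valuativeDim (R : Type*) [CommRing R] [IsDomain R] : 0 ≤ valuativeDim R :=
  ringKrullDim_nonneg_of_nontrivial.trans
    (ringKrullDim_le_valuativeDim R ⊤ fun _ ↦ ValuationSubring.mem_top _)

/-- A finite antitone sequence with at most one repetition becomes strictly antitone on dropping
one of its terms. -/
theorem exists_strictAnti_of_antitone {α : Type*} [PartialOrder α] {V : ℕ → α} (hV : Antitone V)
    (n : ℕ) (h : ∀ i j, i < j → j < n + 1 → V i = V (i + 1) → V j ≠ V (j + 1)) :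
    ∃ U : Fin (n + 1) → α, StrictAnti U ∧ ∀ i, V (n + 1) ≤ U i := by
  have key : ∃ m, ∀ j < n + 1, j ≠ m → V (j + 1) < V j := by
    by_cases hm : ∃ m < n + 1, V m = V (m + 1)
    · obtain ⟨m, hmn, hm⟩ := hm
      refine ⟨m, fun j hj hjm ↦ (hV j.le_succ).lt_of_ne fun he ↦ ?_⟩
      rcases hjm.lt_or_gt with hlt | hlt
      · exact h j m hlt hmn he.symm hm
      · exact h m j hlt hj hm he.symm
    · push Not at hm
      exact ⟨0, fun j hj _ ↦ (hV j.le_succ).lt_of_ne (hm j hj).symm⟩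
  obtain ⟨m, hm⟩ := key
  -- This skips the term of index `m + 1`, the second of the repeated pair; without a repetition `m`
  -- is arbitrary.
  refine ⟨fun i ↦ V (if (i : ℕ) ≤ m then i else i + 1), Fin.strictAnti_iff_succ_lt.mpr fun i ↦ ?_,
    fun i ↦ hV ?_⟩
  · have hi := i.2
    simp only [Fin.val_succ, Fin.val_castSucc]
    rcases lt_trichotomy (i : ℕ) m with hlt | heq | hgt
    · rw [if_pos (by omega), if_pos (by omega)]
      exact hm i (by omega) (by omega)
    · rw [if_neg (by omega), if_pos (by omega)]
      exact (hm (i + 1) (by omega) (by omega)).trans_le (hV (Nat.le_succ _))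
    · rw [if_neg (by omega), if_neg (by omega)]
      exact hm (i + 1) (by omega) (by omega)
  · have := i.2
    split_ifs <;> omega

/-- Let `A ⊆ F` be an algebra of transcendence degree at most one over `R`, where `F` is a field,
and let `K` be the quotient field of `R`. A chain of `n + 2` primes of `A` gives a valuation ring
of `K` that contains `R` and has dimension at least `n`. -/
theorem exists_valuationSubring_le_ringKrullDim {R A K F : Type*} [CommRing R] [IsDomain R]
    [CommRing A] [Field K] [Field F] [Algebra R A] [Algebra R K] [IsFractionRing R K]
    [Algebra R F] [Algebra A F] [IsScalarTower R A F] [FaithfulSMul R F] [FaithfulSMul A F]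
    (htr : Algebra.trdeg R A ≤ 1)
    (p : LTSeries (PrimeSpectrum A)) {n : ℕ} (hn : p.length = n + 1) :
    ∃ V : ValuationSubring K, (∀ r : R, algebraMap R K r ∈ V) ∧ n ≤ ringKrullDim V := by
  obtain ⟨ψ, hψ⟩ : ∃ ψ : K →+* F, ψ.comp (algebraMap R K) = algebraMap R F :=
    have hRF := FaithfulSMul.algebraMap_injective R F
    ⟨IsFractionRing.lift hRF, RingHom.ext fun r ↦ IsFractionRing.lift_algebraMap hRF r⟩
  -- The chain is continued as constant past its end, to index it by `ℕ`.
  let P : ℕ → PrimeSpectrum A := fun k ↦ p ⟨min k p.length, by omega⟩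
  have hPmono : Monotone fun k ↦ (P k).asIdeal :=
    fun i j hij ↦ p.monotone (Fin.mk_le_mk.mpr (by omega))
  have hPlt : ∀ k < n + 1, ∃ t ∈ (P (k + 1)).asIdeal, t ∉ (P k).asIdeal := fun k hk ↦
    SetLike.not_le_iff_exists.mp
      (show P k < P (k + 1) from p.strictMono (Fin.mk_lt_mk.mpr (by omega))).not_ge
  obtain ⟨W, hW, hc⟩ := ValuationSubring.exists_antitone_hasCenter
    (FaithfulSMul.algebraMap_injective A F) (fun k ↦ (P k).isPrime) hPmono
  obtain ⟨U, hU, hle⟩ := exists_strictAnti_of_antitone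
    (V := fun k ↦ (W k).comap ψ) (fun i j hij x hx ↦ hW hij hx) n (by
      intro i j hij hj hi hj'
      obtain ⟨t, ht, ht'⟩ := hPlt i (by omega)
      obtain ⟨s, hs, hs'⟩ := hPlt j hj
      have hind := ValuationSubring.algebraicIndependent_of_comap_eq hψ (hW i.le_succ)
        (hW (Nat.succ_le_of_lt hij)) (hW j.le_succ) hi hj' ((hc i).valuation_eq_one ht')
        (((hc (i + 1)).valuation_lt_one_iff t).mpr ht) ((hc j).valuation_eq_one hs')
        (((hc (j + 1)).valuation_lt_one_iff s).mpr hs)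
      have hindA : AlgebraicIndependent R ![t, s] := by
        refine AlgebraicIndependent.of_comp (IsScalarTower.toAlgHom R A F) ?_
        convert hind using 1
        ext i
        fin_cases i <;> rfl
      have hcard := hindA.lift_cardinalMk_le_trdeg.trans (Cardinal.lift_le.mpr htr)
      simp at hcard)
  refine ⟨(W (n + 1)).comap ψ, fun r ↦ ?_,
    ValuationSubring.le_ringKrullDim_of_strictAnti hU hle⟩
  rw [ValuationSubring.mem_comap, ← RingHom.comp_apply, hψ,
    ← ValuationSubring.valuation_le_one_iff, IsScalarTower.algebraMap_apply R A F]
  exact (hc (n + 1)).valuation_le_one _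

/-- The dimension of an algebra of transcendence degree at most one over a domain `R` is bounded by
the valuative dimension of `R` plus one. -/
theorem ringKrullDim_le_one_add_valuativeDim (R A : Type*) [CommRing R] [IsDomain R] [CommRing A]
    [IsDomain A] [Algebra R A] [FaithfulSMul R A] (htr : Algebra.trdeg R A ≤ 1) :
    ringKrullDim A ≤ 1 + valuativeDim R := by
  refine iSup_le fun p ↦ ?_
  obtain ⟨n, hn⟩ : ∃ n, p.length = n := ⟨_, rfl⟩
  rcases n with _ | n
  · rw [hn]
    exact add_nonneg zero_le_one (zero_le_valuativeDim R)
  obtain ⟨V, hRV, hV⟩ := exists_valuationSubring_le_ringKrullDim (K := FractionRing R)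
    (F := FractionRing A) htr p hn
  rw [hn, Nat.cast_add, Nat.cast_one, add_comm]
  exact add_le_add_right (hV.trans (ringKrullDim_le_valuativeDim R V hRV)) 1

/-! ### Rings of integer-valued polynomials. -/

open Polynomial

section IntPoly

variable {L : Type*} [Field L]

/-- Evaluation at a point of `E`, as a ring homomorphism from `intPoly B E D` to `D`. -/
noncomputable def intPolyEval (B : Subring L) (E : Set L) (D : Subring L) (e : E) :
    intPoly B E D →+* D :=
  ((eval₂RingHom B.subtype (e : L)).comp (intPoly B E D).subtype).codRestrict D
    fun f ↦ f.2 e e.2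

@[simp]
theorem coe_intPolyEval (B : Subring L) (E : Set L) (D : Subring L) (e : E) (f : intPoly B E D) :
    (intPolyEval B E D e f : L) = eval₂ B.subtype e (f : B[X]) := rfl

theorem intPoly_mono (B : Subring L) (E : Set L) {D R : Subring L} (h : D ≤ R) :
    intPoly B E D ≤ intPoly B E R :=
  fun _ hf e he ↦ h (hf e he)

/-- The polynomials of `intPoly B E D` with values in the ideal `I`. -/
noncomputable def intPolyIdeal (B : Subring L) (E : Set L) (D : Subring L) (I : Ideal D) :
    Ideal (intPoly B E D) :=
  ⨅ e : E, I.comap (intPolyEval B E D e)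

theorem mem_intPolyIdeal {B : Subring L} {E : Set L} {D : Subring L} {I : Ideal D}
    {f : intPoly B E D} : f ∈ intPolyIdeal B E D I ↔ ∀ e : E, intPolyEval B E D e f ∈ I := by
  simp [intPolyIdeal]

theorem coe_mem_image_ideal_iff {D : Subring L} {I : Ideal D} (x : D) :
    (x : L) ∈ (Subtype.val '' (I : Set D) : Set L) ↔ x ∈ I :=
  Subtype.val_injective.mem_set_image

theorem ringKrullDim_intPoly_le {D R : Subring L} (B : Subring L) (E : Set L) (hDR : D ≤ R)
    (I : Ideal D) (J : Ideal R)
    (hIJ : (Subtype.val '' (I : Set D) : Set L) = Subtype.val '' (J : Set R))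
    [Finite (D ⧸ I)] : ringKrullDim (intPoly B E D) ≤ ringKrullDim (intPoly B E R) := by
  refine ringKrullDim_le_of_common_ideal (f := Subring.inclusion (intPoly_mono B E hDR))
    (Subring.inclusion_injective _) (J := intPolyIdeal B E D I) (J' := intPolyIdeal B E R J)
    ?_ fun P hP hle ↦ ?_
  · ext f
    constructor
    · rintro ⟨f, hf, rfl⟩
      refine mem_intPolyIdeal.mpr fun e ↦ ?_
      rw [← coe_mem_image_ideal_iff, ← hIJ]
      exact (coe_mem_image_ideal_iff _).mpr (mem_intPolyIdeal.mp hf e)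
    · intro hf
      have hf' (e : E) : eval₂ B.subtype (e : L) (f : B[X]) ∈ (Subtype.val '' (I : Set D)) := by
        rw [hIJ]
        exact (coe_mem_image_ideal_iff _).mpr (mem_intPolyIdeal.mp hf e)
      refine ⟨⟨f, fun e he ↦ ?_⟩, mem_intPolyIdeal.mpr fun e ↦
        (coe_mem_image_ideal_iff _).mp (hf' e), rfl⟩
      obtain ⟨x, -, hx⟩ := hf' ⟨e, he⟩
      exact hx ▸ x.2
  · obtain ⟨m, n, hmn, h⟩ := exists_pow_eq_pow_of_finite (D ⧸ I)
    refine hP.isMaximal_of_pow_sub_pow_mem hmn fun f ↦ hle (mem_intPolyIdeal.mpr fun e ↦ ?_)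
    rw [← Ideal.Quotient.eq_zero_iff_mem, map_sub, map_pow, map_pow, map_sub, map_pow, map_pow, h,
      sub_self]

/-- Constants make evaluation at `e` surjective onto `D`, and the nonzero polynomial `d (X - e)`
lies in its kernel. Pulling back primes of the domain `D` leaves room for the zero ideal below. -/
theorem one_add_ringKrullDim_le_intPoly {D B : Subring L} (hDB : D ≤ B) {E : Set L}
    (hE : E.Nonempty) (hfrac : IsFractionalSubset D E) :
    1 + ringKrullDim D ≤ ringKrullDim (intPoly B E D) := by
  obtain ⟨e, he⟩ := hE
  obtain ⟨d, hd, hd0, hdE⟩ := hfrac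
  let g : B[X] := C ⟨d, hDB hd⟩ * X - C ⟨d * e, hDB (hdE e he)⟩
  have hg (x : L) : eval₂ B.subtype x g = d * x - d * e := by simp [g]
  have hgmem : g ∈ intPoly B E D := fun x hx ↦ by
    rw [hg]
    exact D.sub_mem (hdE x hx) (hdE e he)
  have hg0 : g ≠ 0 := fun h ↦ by
    have := congrArg (fun p ↦ coeff p 1) h
    simp [g, coeff_C, Subtype.ext_iff, hd0] at this
  rw [add_comm]
  refine ringKrullDim_succ_le_of_surjective (intPolyEval B E D ⟨e, he⟩) (fun x ↦ ?_)
    (r := ⟨g, hgmem⟩) ?_ ?_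
  · refine ⟨⟨C ⟨x, hDB x.2⟩, fun y _ ↦ ?_⟩, Subtype.ext ?_⟩ <;> simp
  · exact mem_nonZeroDivisors_of_ne_zero fun h ↦ hg0 (Subtype.ext_iff.mp h)
  · ext
    simp [hg]

/-- A polynomial taking values in a subfield at infinitely many points of the subfield has
coefficients in the subfield. -/
theorem Polynomial.coeff_mem_of_infinite (K : Subfield L) {E : Set L} (hE : E.Infinite)
    (hEK : E ⊆ K) (f : L[X]) (hf : ∀ e ∈ E, f.eval e ∈ K) (n : ℕ) : f.coeff n ∈ K := by
  classical
  obtain ⟨s, hsE, hs⟩ := hE.exists_subset_card_eq (f.natDegree + 1)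
  let g : K[X] := Lagrange.interpolate s.attach (fun e ↦ ⟨e, hEK (hsE e.2)⟩)
    fun e ↦ ⟨f.eval e, hf e (hsE e.2)⟩
  have hinj : Set.InjOn (fun e : s ↦ (⟨e, hEK (hsE e.2)⟩ : K)) s.attach := fun a _ b _ h ↦
    Subtype.ext (congrArg (fun z : K ↦ (z : L)) h)
  have hfg : f = g.map K.subtype := by
    refine eq_of_degrees_lt_of_eval_finset_eq s ?_ ?_ fun x hx ↦ ?_
    · rw [hs]
      exact degree_le_natDegree.trans_lt (by exact_mod_cast Nat.lt_succ_self _)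
    · refine degree_map_le.trans_lt ?_
      have := Lagrange.degree_interpolate_lt (fun e : s ↦ (⟨f.eval e, hf e (hsE e.2)⟩ : K)) hinj
      rwa [Finset.card_attach] at this
    · have := Lagrange.eval_interpolate_at_node (fun e : s ↦ (⟨f.eval e, hf e (hsE e.2)⟩ : K)) hinj
        (Finset.mem_attach s ⟨x, hx⟩)
      have h2 : (g.map K.subtype).eval (K.subtype ⟨x, hEK (hsE hx)⟩) = f.eval x := by
        rw [eval_map_apply]
        exact congrArg Subtype.val this
      exact h2.symm
  rw [hfg, coeff_map]
  exact (g.coeff n).2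

theorem isAlgebraic_of_mem_closure {R : Subring L} {x : L}
    (hx : x ∈ Subfield.closure (R : Set L)) : IsAlgebraic R x := by
  rw [Subfield.mem_closure_iff] at hx
  obtain ⟨y, hy, z, hz, rfl⟩ := hx
  rw [Subring.closure_eq] at hy hz
  rw [div_eq_mul_inv]
  exact (isAlgebraic_algebraMap (⟨y, hy⟩ : R)).mul (isAlgebraic_algebraMap (⟨z, hz⟩ : R)).inv

theorem isAlgebraic_coeff_of_mem_intPoly {R B : Subring L} {E : Set L} (hE : E.Infinite)
    (hER : E ⊆ R) {f : B[X]} (hf : f ∈ intPoly B E R) (n : ℕ) : IsAlgebraic R (f.coeff n : L) := by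
  apply isAlgebraic_of_mem_closure
  have := Polynomial.coeff_mem_of_infinite (Subfield.closure (R : Set L)) hE
    (hER.trans Subfield.subset_closure) (f.map B.subtype)
    (fun e he ↦ Subfield.subset_closure (by rw [eval_map]; exact hf e he)) n
  rwa [coeff_map] at this

/-- A polynomial whose coefficients are algebraic over `R` is algebraic over every extension of `R`
that contains `X`. -/
theorem Polynomial.isAlgebraic_of_isAlgebraic_coeff {R B T : Type*} [CommRing R] [CommRing B]
    [Algebra R B] [CommRing T] [IsDomain T] [Algebra R T] [FaithfulSMul R T]
    [Algebra T B[X]] [IsScalarTower R T B[X]] {x : T} (hx : algebraMap T B[X] x = X) {f : B[X]}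
    (hf : ∀ n, IsAlgebraic R (f.coeff n)) : IsAlgebraic T f := by
  rw [f.as_sum_range_C_mul_X_pow]
  refine Finset.sum_induction _ (IsAlgebraic T) (fun _ _ ↦ IsAlgebraic.add) isAlgebraic_zero
    fun n _ ↦ IsAlgebraic.mul ?_ (IsAlgebraic.pow ?_ n)
  · have : IsAlgebraic R (C (f.coeff n)) := (hf n).algebraMap
    exact this.extendScalars (FaithfulSMul.algebraMap_injective R T)
  · exact hx ▸ isAlgebraic_algebraMap x

/-- Since `E ⊆ R`, the ring contains `X`; algebraic coefficients make it algebraic over `R[X]`,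
hence of transcendence degree at most one over `R`. -/
theorem ringKrullDim_intPoly_le_one_add_valuativeDim {R B : Subring L} (hRB : R ≤ B) {E : Set L}
    (hER : E ⊆ R) (halg : ∀ f ∈ intPoly B E R, ∀ n, IsAlgebraic R (f.coeff n : L)) :
    ringKrullDim (intPoly B E R) ≤ 1 + valuativeDim R := by
  let : Algebra R B := (Subring.inclusion hRB).toAlgebra
  have : FaithfulSMul R B :=
    (faithfulSMul_iff_algebraMap_injective R B).mpr (Subring.inclusion_injective hRB)
  have : IsScalarTower R B L := .of_algebraMap_eq fun _ ↦ rfl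
  let φ : R →+* intPoly B E R := (algebraMap R B[X]).codRestrict (intPoly B E R) fun r e _ ↦ by
    rw [IsScalarTower.algebraMap_apply R B B[X], algebraMap_eq, eval₂_C]
    exact r.2
  let : Algebra R (intPoly B E R) := φ.toAlgebra
  have : IsScalarTower R (intPoly B E R) B[X] := .of_algebraMap_eq fun _ ↦ rfl
  have : FaithfulSMul R (intPoly B E R) := by
    refine (faithfulSMul_iff_algebraMap_injective R _).mpr fun a b h ↦ ?_
    exact FaithfulSMul.algebraMap_injective R B[X] (congrArg Subtype.val h)
  let x : intPoly B E R := ⟨X, fun e he ↦ by rw [eval₂_X]; exact hER he⟩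
  have : Algebra.IsAlgebraic (Algebra.adjoin R {x}) (intPoly B E R) := by
    refine ⟨fun f ↦ ?_⟩
    refine (isAlgebraic_algebraMap_iff (A := B[X]) Subtype.val_injective).mp
      (Polynomial.isAlgebraic_of_isAlgebraic_coeff (R := R)
        (x := ⟨x, Algebra.self_mem_adjoin_singleton R x⟩) rfl fun n ↦ ?_)
    exact (isAlgebraic_algebraMap_iff (A := L) Subtype.val_injective).mp (halg f f.2 n)
  apply ringKrullDim_le_one_add_valuativeDim
  exact (Algebra.IsAlgebraic.trdeg_le_cardinalMk R {x}).trans (by simp)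

end IntPoly

theorem theorem4 {L : Type*} [Field L] (D R B : Subring L) (hDR : D ≤ R) (hRB : R ≤ B)
    (I : Ideal D) (J : Ideal R)
    (hIJ : (Subtype.val '' (I : Set D) : Set L) = Subtype.val '' (J : Set R))
    (hI : I ≠ ⊥) (hfin : Finite (D ⧸ I))
    (E : Set L) (hE : E.Nonempty)
    (hEK : E ⊆ (Subfield.closure (D : Set L) : Set L)) :
    ringKrullDim (intPoly B E D) ≤ ringKrullDim (intPoly B E R) ∧
    (IsFractionalSubset D E → E ⊆ (R : Set L) →
      1 + ringKrullDim D ≤ ringKrullDim (intPoly B E D) ∧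
      ((E.Infinite ∨ ∀ b ∈ B, IsAlgebraic D b) →
        ringKrullDim (intPoly B E D) ≤ 1 + valuativeDim R)) := by
  have hle := ringKrullDim_intPoly_le B E hDR I J hIJ
  refine ⟨hle, fun hfrac hER ↦ ⟨one_add_ringKrullDim_le_intPoly (hDR.trans hRB) hE hfrac,
    fun h ↦ hle.trans (ringKrullDim_intPoly_le_one_add_valuativeDim hRB hER fun f hf n ↦ ?_)⟩⟩
  rcases h with h | h
  · exact isAlgebraic_coeff_of_mem_intPoly h hER hf n
  · let : Algebra D R := (Subring.inclusion hDR).toAlgebra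
    have : IsScalarTower D R L := .of_algebraMap_eq fun _ ↦ rfl
    exact (h _ (f.coeff n).2).extendScalars (Subring.inclusion_injective hDR)
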